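/- For $k\ge 1$ let $M_k(\mathbb C)$ be the $k\times k$ complex matrices with the Hilbert--Schmidt inner product $\langle X,Y\rangle=\mathrm{tr}[X^*Y]$. Let $m,n\ge 1$ be integers and let $\Phi:M_m(\mathbb C)\to M_n(\mathbb C)$ be a linear map, with adjoint $\Phi^\dagger:M_n(\mathbb C)\to M_m(\mathbb C)$ with respect to these inner products. Suppose that $\Phi$ is a Schwarz map, i.e. $\Phi(K^*K)\ge\Phi(K)^*\Phi(K)$ for all $K\in M_m(\mathbb C)$, and that $\Phi$ is sesquiunital, i.e. $\Phi(\mathbf 1)=\mathbf 1$ and $\Phi^\dagger(\mathbf 1)=\frac nm\mathbf 1$. Let $0\le s<1$ and $\frac1{2-s}\le q<1$. Then for every positive definite $A\in M_n(\mathbb C)$ and every invertible $B\in M_n(\mathbb C)$, $$\left(\frac nm\right)^{(2-s)q-1}\mathrm{tr}\big[(B^*A^{-s}B)^q\big]\ \ge\ \mathrm{tr}\big[(\Phi^\dagger(B)^*\,\Phi^\dagger(A)^{-s}\,\Phi^\dagger(B))^q\big].$$ -/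

import Mathlib

open scoped Matrix ComplexOrder MatrixOrder

namespace SesquiunitalSchwarz

/-- The Hilbert--Schmidt inner product `⟪X, Y⟫ = tr[X* Y]` on `k × k` complex matrices. -/
def hsInner {k : ℕ} (X Y : Matrix (Fin k) (Fin k) ℂ) : ℂ :=
  (Xᴴ * Y).trace

/-- The adjoint `Φ†` of a linear map `Φ : M_m(ℂ) → M_n(ℂ)` for the Hilbert--Schmidt inner
products, given by its matrix entries `(Φ† Y)_{ij} = ⟪E_ij, Φ† Y⟫ = ⟪Φ(E_ij), Y⟫`.  The two
lemmas that follow show that it is the adjoint. -/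
def hsAdjoint {m n : ℕ}
    (Φ : Matrix (Fin m) (Fin m) ℂ →ₗ[ℂ] Matrix (Fin n) (Fin n) ℂ) :
    Matrix (Fin n) (Fin n) ℂ →ₗ[ℂ] Matrix (Fin m) (Fin m) ℂ where
  toFun Y := Matrix.of fun i j => hsInner (Φ (Matrix.single i j 1)) Y
  map_add' Y Z := by
    ext i j
    simp [hsInner, mul_add]
  map_smul' c Y := by
    ext i j
    simp [hsInner]

/-- The defining property of the adjoint: `⟪X, Φ† Y⟫ = ⟪Φ X, Y⟫`. -/
theorem hsInner_hsAdjoint {m n : ℕ}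
    (Φ : Matrix (Fin m) (Fin m) ℂ →ₗ[ℂ] Matrix (Fin n) (Fin n) ℂ)
    (X : Matrix (Fin m) (Fin m) ℂ) (Y : Matrix (Fin n) (Fin n) ℂ) :
    hsInner X (hsAdjoint Φ Y) = hsInner (Φ X) Y := by
  induction X using Matrix.induction_on' with
  | h_zero => simp [hsInner]
  | h_add X₁ X₂ h₁ h₂ =>
    simp only [hsInner, map_add, Matrix.conjTranspose_add, add_mul, Matrix.trace_add] at *
    rw [h₁, h₂]
  | h_std_basis i j c =>
    have hc : Matrix.single i j c = c • Matrix.single i j (1 : ℂ) := by simp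
    have h1 : hsInner (Matrix.single i j (1 : ℂ)) (hsAdjoint Φ Y)
        = hsInner (Φ (Matrix.single i j 1)) Y := by
      simp [hsInner, hsAdjoint, Matrix.conjTranspose_single, Matrix.trace_single_mul]
    rw [hc, map_smul]
    simp only [hsInner, Matrix.conjTranspose_smul, Matrix.smul_mul, Matrix.trace_smul] at *
    rw [h1]

/-- The defining property determines the adjoint. -/
theorem eq_hsAdjoint {m n : ℕ}
    (Φ : Matrix (Fin m) (Fin m) ℂ →ₗ[ℂ] Matrix (Fin n) (Fin n) ℂ)
    (Ψ : Matrix (Fin n) (Fin n) ℂ →ₗ[ℂ] Matrix (Fin m) (Fin m) ℂ)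
    (h : ∀ X Y, hsInner X (Ψ Y) = hsInner (Φ X) Y) : Ψ = hsAdjoint Φ := by
  ext Y i j
  simp only [hsAdjoint, LinearMap.coe_mk,
    AddHom.coe_mk, Matrix.of_apply, ← h]
  simp [hsInner, Matrix.conjTranspose_single, Matrix.trace_single_mul]

/-- `Φ` is a Schwarz map: `Φ(K* K) ≥ Φ(K)* Φ(K)` for all `K`. -/
def IsSchwarzMap {m n : ℕ}
    (Φ : Matrix (Fin m) (Fin m) ℂ →ₗ[ℂ] Matrix (Fin n) (Fin n) ℂ) : Prop :=
  ∀ K : Matrix (Fin m) (Fin m) ℂ, (Φ (Kᴴ * K) - (Φ K)ᴴ * Φ K).PosSemidef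

/-- `Φ` is unital: `Φ(1) = 1`. -/
def IsUnital {m n : ℕ}
    (Φ : Matrix (Fin m) (Fin m) ℂ →ₗ[ℂ] Matrix (Fin n) (Fin n) ℂ) : Prop :=
  Φ 1 = 1

/-- `Φ : M_m(ℂ) → M_n(ℂ)` is semiunital: `Φ†(1) = (n / m) 1`. -/
def IsSemiunital {m n : ℕ}
    (Φ : Matrix (Fin m) (Fin m) ℂ →ₗ[ℂ] Matrix (Fin n) (Fin n) ℂ) : Prop :=
  hsAdjoint Φ 1 = ((n : ℂ) / (m : ℂ)) • (1 : Matrix (Fin m) (Fin m) ℂ)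

/-- `Φ` is sesquiunital: unital and semiunital. -/
def IsSesquiunital {m n : ℕ}
    (Φ : Matrix (Fin m) (Fin m) ℂ →ₗ[ℂ] Matrix (Fin n) (Fin n) ℂ) : Prop :=
  IsUnital Φ ∧ IsSemiunital Φ

end SesquiunitalSchwarz

/-!
The squared weighted Hilbert--Schmidt norms `tr[K* Aˢ K Cʳ]` form an interpolation scale in
`(s, r)`. In eigenbases of `A` and `C` they are weighted `ℓ²` norms; two such norms with weights
`t a` and `b` have an infimal convolution whose weight is the parallel sum `t a b / (t a + b)`, and
`a^(1-θ) b^θ` is an integral of these parallel sums over `t`. With `A` and `C` on the target of `Φ`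
and `Φ†(A)` and `Φ†(C)` on its source, the Schwarz inequality bounds `Φ` by `1` at the vertices
`(1, 0)` and `(0, 1)`, and `Φ†(1) ≤ c 1` bounds it by `c` at `(0, 0)`. Interpolation over the
triangle `s + r ≤ 1` gives the bound `c^(1-s-r)`, and duality turns it into
`tr[Φ†(B)* Φ†(A)⁻ˢ Φ†(B) Φ†(C)⁻ʳ] ≤ c^(1-s-r) tr[B* A⁻ˢ B C⁻ʳ]`.

Take `r = 1/q - 1`; then `s + r ≤ 1` is the condition `1/(2-s) ≤ q`. For `Z = B* A⁻ˢ B`, Young's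
inequality gives `tr Z^q ≤ q tr[Z C⁻ʳ] + (1-q) tr C` for every positive definite `C`, and likewise
with `Φ†(B)`, `Φ†(A)` and `Φ†(C)`, where `tr Φ†(C) ≤ tr C` because `Φ(1) ≤ 1`. Choosing `C` close
to `t Z^q` with `t = c^((2-s)q-1)` makes `c^(1-s-r) tr[Z C⁻ʳ]` and `tr C` both close to
`t tr Z^q`.
-/

namespace SesquiunitalSchwarz

section WeightedInterpolation

/-- The squared norm of a weighted `ℓ²` space, `∑ᵢ wᵢ ‖uᵢ‖²`. Interpolation between two such norms
is interpolation between their weights. -/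
def weightedNormSq {ι E : Type*} [Fintype ι] [Norm E] (w : ι → ℝ) (u : ι → E) : ℝ :=
  ∑ i, w i * ‖u i‖ ^ 2

theorem weightedNormSq_const_mul {ι E : Type*} [Fintype ι] [Norm E] (c : ℝ) (w : ι → ℝ)
    (u : ι → E) : weightedNormSq (fun i => c * w i) u = c * weightedNormSq w u := by
  simp only [weightedNormSq, mul_assoc, Finset.mul_sum]

variable {ι κ E F : Type*} [Fintype ι] [Fintype κ] [NormedAddCommGroup E] [NormedSpace ℝ E]
  [NormedAddCommGroup F]

theorem parallel_mul_norm_add_sq_le {a b : ℝ} (ha : 0 < a) (hb : 0 < b) (x y : F) :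
    a * b / (a + b) * ‖x + y‖ ^ 2 ≤ a * ‖x‖ ^ 2 + b * ‖y‖ ^ 2 := by
  have hsq : ‖x + y‖ ^ 2 ≤ (‖x‖ + ‖y‖) ^ 2 := by gcongr; exact norm_add_le x y
  have hgap : a * ‖x‖ ^ 2 + b * ‖y‖ ^ 2 - a * b / (a + b) * (‖x‖ + ‖y‖) ^ 2 =
      (a * ‖x‖ - b * ‖y‖) ^ 2 / (a + b) := by
    field_simp
    ring
  calc a * b / (a + b) * ‖x + y‖ ^ 2 ≤ a * b / (a + b) * (‖x‖ + ‖y‖) ^ 2 := by gcongr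
    _ ≤ a * ‖x‖ ^ 2 + b * ‖y‖ ^ 2 := by
      rw [← sub_nonneg, hgap]
      positivity

theorem exists_add_eq_and_parallel_mul_norm_sq_eq {a b : ℝ} (ha : 0 < a) (hb : 0 < b) (z : E) :
    ∃ x y : E, x + y = z ∧ a * ‖x‖ ^ 2 + b * ‖y‖ ^ 2 = a * b / (a + b) * ‖z‖ ^ 2 := by
  refine ⟨(b / (a + b)) • z, (a / (a + b)) • z, ?_, ?_⟩
  · rw [← add_smul, ← add_div, add_comm b a, div_self (by positivity), one_smul]
  · rw [norm_smul_of_nonneg (by positivity), norm_smul_of_nonneg (by positivity)]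
    field_simp
    ring

theorem weightedNormSq_parallel_le (T : (ι → E) →+ (κ → F)) {α₀ α₁ : ι → ℝ} {β₀ β₁ : κ → ℝ}
    (hα₀ : ∀ i, 0 < α₀ i) (hα₁ : ∀ i, 0 < α₁ i) (hβ₀ : ∀ j, 0 < β₀ j) (hβ₁ : ∀ j, 0 < β₁ j)
    (h₀ : ∀ u, weightedNormSq β₀ (T u) ≤ weightedNormSq α₀ u)
    (h₁ : ∀ u, weightedNormSq β₁ (T u) ≤ weightedNormSq α₁ u) (u : ι → E) :
    weightedNormSq (fun j => β₀ j * β₁ j / (β₀ j + β₁ j)) (T u) ≤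
      weightedNormSq (fun i => α₀ i * α₁ i / (α₀ i + α₁ i)) u := by
  choose x y hxy hopt using fun i =>
    exists_add_eq_and_parallel_mul_norm_sq_eq (hα₀ i) (hα₁ i) (u i)
  obtain rfl : x + y = u := funext hxy
  calc weightedNormSq (fun j => β₀ j * β₁ j / (β₀ j + β₁ j)) (T (x + y))
      ≤ weightedNormSq β₀ (T x) + weightedNormSq β₁ (T y) := by
        rw [map_add, weightedNormSq, weightedNormSq, weightedNormSq, ← Finset.sum_add_distrib]
        exact Finset.sum_le_sum fun j _ => parallel_mul_norm_add_sq_le (hβ₀ j) (hβ₁ j) _ _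
    _ ≤ weightedNormSq α₀ x + weightedNormSq α₁ y := add_le_add (h₀ x) (h₁ y)
    _ = weightedNormSq (fun i => α₀ i * α₁ i / (α₀ i + α₁ i)) (x + y) := by
        rw [weightedNormSq, weightedNormSq, weightedNormSq, ← Finset.sum_add_distrib]
        exact Finset.sum_congr rfl fun i _ => hopt i

theorem exists_measure_rpow_mul_rpow_eq_integral {θ : ℝ} (hθ : θ ∈ Set.Ioo (0 : ℝ) 1) :
    ∃ μ : MeasureTheory.Measure ℝ, ∀ a b : ℝ, 0 < a → 0 < b →
      MeasureTheory.IntegrableOn (fun t => t ^ (θ - 2) * (t * a * b / (t * a + b)))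
        (Set.Ioi 0) μ ∧
      a ^ (1 - θ) * b ^ θ = ∫ t in Set.Ioi 0, t ^ (θ - 2) * (t * a * b / (t * a + b)) ∂μ := by
  obtain ⟨μ, hμ⟩ := Real.exists_measure_rpow_eq_integral_rpowIntegrand₀₁ hθ
  refine ⟨μ, fun a b ha hb => ?_⟩
  obtain ⟨hint, hpow⟩ := hμ (b / a) (div_pos hb ha).le
  have hkernel : Set.EqOn (fun t => a * Real.rpowIntegrand₀₁ θ t (b / a))
      (fun t => t ^ (θ - 2) * (t * a * b / (t * a + b))) (Set.Ioi 0) := by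
    intro t (ht : 0 < t)
    have hexp : t ^ (θ - 1) = t ^ (θ - 2) * t := by
      rw [← Real.rpow_add_one ht.ne', sub_add, show (2 : ℝ) - 1 = 1 by norm_num]
    simp only [Real.rpowIntegrand₀₁_eq_pow_div hθ ht.le (div_pos hb ha).le, hexp]
    field_simp
  refine ⟨(MeasureTheory.integrableOn_congr_fun hkernel measurableSet_Ioi).1 (hint.const_mul a),
    ?_⟩
  rw [← MeasureTheory.setIntegral_congr_fun measurableSet_Ioi hkernel,
    MeasureTheory.integral_const_mul, ← hpow, Real.div_rpow hb.le ha.le,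
    Real.rpow_sub ha, Real.rpow_one]
  ring

theorem weightedNormSq_interpolate (T : (ι → E) →+ (κ → F)) {α₀ α₁ : ι → ℝ} {β₀ β₁ : κ → ℝ}
    (hα₀ : ∀ i, 0 < α₀ i) (hα₁ : ∀ i, 0 < α₁ i) (hβ₀ : ∀ j, 0 < β₀ j) (hβ₁ : ∀ j, 0 < β₁ j)
    (h₀ : ∀ u, weightedNormSq β₀ (T u) ≤ weightedNormSq α₀ u)
    (h₁ : ∀ u, weightedNormSq β₁ (T u) ≤ weightedNormSq α₁ u)
    {θ : ℝ} (hθ : θ ∈ Set.Icc (0 : ℝ) 1) (u : ι → E) :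
    weightedNormSq (fun j => β₀ j ^ (1 - θ) * β₁ j ^ θ) (T u) ≤
      weightedNormSq (fun i => α₀ i ^ (1 - θ) * α₁ i ^ θ) u := by
  rcases eq_or_ne θ 0 with rfl | hθ0
  · simpa using h₀ u
  rcases eq_or_ne θ 1 with rfl | hθ1
  · simpa using h₁ u
  obtain ⟨μ, hμ⟩ := exists_measure_rpow_mul_rpow_eq_integral
    ⟨hθ.1.lt_of_ne' hθ0, hθ.2.lt_of_ne hθ1⟩
  have hβ j := hμ _ _ (hβ₀ j) (hβ₁ j)
  have hα i := hμ _ _ (hα₀ i) (hα₁ i)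
  simp only [weightedNormSq, (hβ _).2, (hα _).2, ← MeasureTheory.integral_mul_const]
  rw [← MeasureTheory.integral_finsetSum _ fun j _ => (hβ j).1.mul_const _,
    ← MeasureTheory.integral_finsetSum _ fun i _ => (hα i).1.mul_const _]
  refine MeasureTheory.setIntegral_mono_on
    (MeasureTheory.integrable_finsetSum _ fun j _ => (hβ j).1.mul_const _)
    (MeasureTheory.integrable_finsetSum _ fun i _ => (hα i).1.mul_const _)
    measurableSet_Ioi fun t (ht : 0 < t) => ?_
  have hscaled : ∀ v, weightedNormSq (fun j => t * β₀ j) (T v) ≤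
      weightedNormSq (fun i => t * α₀ i) v := fun v => by
    rw [weightedNormSq_const_mul, weightedNormSq_const_mul]
    exact mul_le_mul_of_nonneg_left (h₀ v) ht.le
  have hpar := weightedNormSq_parallel_le T (fun i => mul_pos ht (hα₀ i)) hα₁
    (fun j => mul_pos ht (hβ₀ j)) hβ₁ hscaled h₁ u
  have hpar' := mul_le_mul_of_nonneg_left hpar (Real.rpow_nonneg ht.le (θ - 2))
  rwa [← weightedNormSq_const_mul, ← weightedNormSq_const_mul] at hpar'

theorem weightedNormSq_interpolate_of_le_const_mul (T : (ι → E) →+ (κ → F))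
    {α₀ α₁ : ι → ℝ} {β₀ β₁ : κ → ℝ}
    (hα₀ : ∀ i, 0 < α₀ i) (hα₁ : ∀ i, 0 < α₁ i) (hβ₀ : ∀ j, 0 < β₀ j) (hβ₁ : ∀ j, 0 < β₁ j)
    {k₀ k₁ : ℝ} (hk₀ : 0 < k₀) (hk₁ : 0 < k₁)
    (h₀ : ∀ u, weightedNormSq β₀ (T u) ≤ k₀ * weightedNormSq α₀ u)
    (h₁ : ∀ u, weightedNormSq β₁ (T u) ≤ k₁ * weightedNormSq α₁ u)
    {θ : ℝ} (hθ : θ ∈ Set.Icc (0 : ℝ) 1) (u : ι → E) :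
    weightedNormSq (fun j => β₀ j ^ (1 - θ) * β₁ j ^ θ) (T u) ≤
      k₀ ^ (1 - θ) * k₁ ^ θ * weightedNormSq (fun i => α₀ i ^ (1 - θ) * α₁ i ^ θ) u := by
  simp only [← weightedNormSq_const_mul] at h₀ h₁
  have h := weightedNormSq_interpolate T (fun i => mul_pos hk₀ (hα₀ i))
    (fun i => mul_pos hk₁ (hα₁ i)) hβ₀ hβ₁ h₀ h₁ hθ u
  simpa only [Real.mul_rpow hk₀.le (hα₀ _).le, Real.mul_rpow hk₁.le (hα₁ _).le,
    mul_mul_mul_comm, weightedNormSq_const_mul] using h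

end WeightedInterpolation

section HilbertSchmidt

variable {ι κ : Type*} [Fintype ι] [Fintype κ]

theorem trace_mul_nonneg {P Q : Matrix ι ι ℂ} (hP : P.PosSemidef) (hQ : Q.PosSemidef) :
    0 ≤ (P * Q).trace := by
  classical
  obtain ⟨L, rfl⟩ := CStarAlgebra.nonneg_iff_eq_star_mul_self.1 hP.nonneg
  rw [Matrix.mul_assoc, Matrix.trace_mul_comm]
  exact (hQ.mul_mul_conjTranspose_same L).trace_nonneg

theorem trace_rpow_eq_ofReal_re [DecidableEq ι] (A : Matrix ι ι ℂ) (x : ℝ) :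
    (A ^ x).trace = ((A ^ x).trace.re : ℂ) := by
  have h : 0 ≤ (A ^ x).trace :=
    (Matrix.nonneg_iff_posSemidef.1 (CFC.rpow_nonneg (a := A) (y := x))).trace_nonneg
  exact Complex.eq_re_of_ofReal_le (r := 0) (by rwa [Complex.ofReal_zero])

theorem re_trace_mul_le_re_trace_mul {P P' Q : Matrix ι ι ℂ} (hP : P ≤ P')
    (hQ : Q.PosSemidef) : (P * Q).trace.re ≤ (P' * Q).trace.re := by
  have h := (Complex.le_def.1 (trace_mul_nonneg (Matrix.le_iff.1 hP) hQ)).1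
  rw [sub_mul, Matrix.trace_sub, Complex.sub_re, Complex.zero_re] at h
  exact sub_nonneg.1 h

/-- The squared weighted Hilbert--Schmidt norm `‖P ^ (1 / 2) * K * Q ^ (1 / 2)‖²`, written as
`tr[K* P K Q]` so that no square roots of the weights `P` and `Q` are needed. -/
def weightedHSNormSq (P : Matrix ι ι ℂ) (Q : Matrix κ κ ℂ) (K : Matrix ι κ ℂ) : ℝ :=
  (Kᴴ * P * K * Q).trace.re

theorem weightedHSNormSq_nonneg {P : Matrix ι ι ℂ} {Q : Matrix κ κ ℂ}
    (hP : P.PosSemidef) (hQ : Q.PosSemidef) (K : Matrix ι κ ℂ) : 0 ≤ weightedHSNormSq P Q K :=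
  (Complex.le_def.1 (trace_mul_nonneg (hP.conjTranspose_mul_mul_same K) hQ)).1

variable [DecidableEq ι] [DecidableEq κ]

/-- The entries of `K` in eigenbases of the Hermitian matrices `A` (rows) and `C` (columns). -/
noncomputable def eigenCoords {A : Matrix ι ι ℂ} {C : Matrix κ κ ℂ} (hA : A.IsHermitian)
    (hC : C.IsHermitian) : Matrix ι κ ℂ ≃+ (ι × κ → ℂ) where
  toFun K p := (star (hA.eigenvectorUnitary : Matrix ι ι ℂ) * K *
    (hC.eigenvectorUnitary : Matrix κ κ ℂ)) p.1 p.2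
  invFun u := (hA.eigenvectorUnitary : Matrix ι ι ℂ) * Matrix.of (fun i j => u (i, j)) *
    star (hC.eigenvectorUnitary : Matrix κ κ ℂ)
  left_inv K := by
    have h : (hA.eigenvectorUnitary : Matrix ι ι ℂ) *
        (star (hA.eigenvectorUnitary : Matrix ι ι ℂ) * K *
          (hC.eigenvectorUnitary : Matrix κ κ ℂ)) *
        star (hC.eigenvectorUnitary : Matrix κ κ ℂ) = K := by
      rw [← Matrix.mul_assoc, ← Matrix.mul_assoc,
        Unitary.mul_star_self_of_mem hA.eigenvectorUnitary.2, Matrix.one_mul, Matrix.mul_assoc,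
        Unitary.mul_star_self_of_mem hC.eigenvectorUnitary.2, Matrix.mul_one]
    exact h
  right_inv u := by
    have h : star (hA.eigenvectorUnitary : Matrix ι ι ℂ) *
        ((hA.eigenvectorUnitary : Matrix ι ι ℂ) * Matrix.of (fun i j => u (i, j)) *
          star (hC.eigenvectorUnitary : Matrix κ κ ℂ)) *
        (hC.eigenvectorUnitary : Matrix κ κ ℂ) = Matrix.of (fun i j => u (i, j)) := by
      rw [← Matrix.mul_assoc, ← Matrix.mul_assoc,
        Unitary.star_mul_self_of_mem hA.eigenvectorUnitary.2, Matrix.one_mul, Matrix.mul_assoc,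
        Unitary.star_mul_self_of_mem hC.eigenvectorUnitary.2, Matrix.mul_one]
    exact funext fun p => congrFun (congrFun h p.1) p.2
  map_add' K L := by
    ext p
    rw [Matrix.mul_add, Matrix.add_mul]
    rfl

theorem weightedHSNormSq_diagonal (a : ι → ℝ) (c : κ → ℝ) (K : Matrix ι κ ℂ) :
    weightedHSNormSq (Matrix.diagonal fun i => (a i : ℂ)) (Matrix.diagonal fun j => (c j : ℂ)) K =
      weightedNormSq (fun p : ι × κ => a p.1 * c p.2) (fun p => K p.1 p.2) := by
  rw [weightedHSNormSq, weightedNormSq, Fintype.sum_prod_type_right, Matrix.trace,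
    Complex.re_sum]
  refine Finset.sum_congr rfl fun j _ => ?_
  rw [Matrix.diag_apply, Matrix.mul_diagonal, Matrix.mul_apply, Finset.sum_mul, Complex.re_sum]
  refine Finset.sum_congr rfl fun i _ => ?_
  rw [Matrix.mul_diagonal, Matrix.conjTranspose_apply, Complex.star_def, ← Complex.ofReal_re
    (a i * c j * ‖K i j‖ ^ 2)]
  push_cast
  rw [← Complex.conj_mul']
  ring_nf

/-- The entries of the tensor `A ^ a ⊗ C ^ b` that weighs the coordinates `eigenCoords hA hC`. -/
noncomputable def eigenWeight {A : Matrix ι ι ℂ} {C : Matrix κ κ ℂ} (hA : A.IsHermitian)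
    (hC : C.IsHermitian) (a b : ℝ) (p : ι × κ) : ℝ :=
  hA.eigenvalues p.1 ^ a * hC.eigenvalues p.2 ^ b

theorem eigenWeight_pos {A : Matrix ι ι ℂ} {C : Matrix κ κ ℂ} (hA : A.PosDef) (hC : C.PosDef)
    (a b : ℝ) (p : ι × κ) : 0 < eigenWeight hA.1 hC.1 a b p :=
  mul_pos (Real.rpow_pos_of_pos (hA.eigenvalues_pos _) _)
    (Real.rpow_pos_of_pos (hC.eigenvalues_pos _) _)

theorem eigenWeight_rpow_mul_rpow {A : Matrix ι ι ℂ} {C : Matrix κ κ ℂ} (hA : A.PosDef)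
    (hC : C.PosDef) (a₀ b₀ a₁ b₁ u v : ℝ) (p : ι × κ) :
    eigenWeight hA.1 hC.1 a₀ b₀ p ^ u * eigenWeight hA.1 hC.1 a₁ b₁ p ^ v =
      eigenWeight hA.1 hC.1 (u * a₀ + v * a₁) (u * b₀ + v * b₁) p := by
  have hx := hA.eigenvalues_pos p.1
  have hy := hC.eigenvalues_pos p.2
  simp only [eigenWeight]
  rw [Real.mul_rpow (by positivity) (by positivity), Real.mul_rpow (by positivity)
    (by positivity), Real.rpow_add hx, Real.rpow_add hy]
  simp only [← Real.rpow_mul hx.le, ← Real.rpow_mul hy.le, mul_comm _ u, mul_comm _ v]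
  ring

theorem weightedHSNormSq_rpow {A : Matrix ι ι ℂ} {C : Matrix κ κ ℂ} (hA : A.PosSemidef)
    (hC : C.PosSemidef) (a b : ℝ) (K : Matrix ι κ ℂ) :
    weightedHSNormSq (A ^ a) (C ^ b) K =
      weightedNormSq (eigenWeight hA.1 hC.1 a b) (eigenCoords hA.1 hC.1 K) := by
  refine Eq.trans ?_ (weightedHSNormSq_diagonal (fun i => hA.1.eigenvalues i ^ a)
    (fun j => hC.1.eigenvalues j ^ b) (star (hA.1.eigenvectorUnitary : Matrix ι ι ℂ) * K *
      (hC.1.eigenvectorUnitary : Matrix κ κ ℂ)))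
  rw [weightedHSNormSq, weightedHSNormSq, CFC.rpow_eq_cfc_real hA.nonneg,
    CFC.rpow_eq_cfc_real hC.nonneg, hA.1.cfc_eq, hC.1.cfc_eq, Matrix.IsHermitian.cfc,
    Matrix.IsHermitian.cfc, Unitary.conjStarAlgAut_apply, Unitary.conjStarAlgAut_apply,
    Matrix.star_eq_conjTranspose, Matrix.star_eq_conjTranspose, ← Matrix.mul_assoc,
    Matrix.trace_mul_comm]
  simp only [Matrix.conjTranspose_mul, Matrix.conjTranspose_conjTranspose, Matrix.mul_assoc]
  rfl

theorem weightedHSNormSq_interpolate {ι' κ' : Type*} [Fintype ι'] [DecidableEq ι'] [Fintype κ']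
    [DecidableEq κ'] (T : Matrix ι κ ℂ →+ Matrix ι' κ' ℂ)
    {A : Matrix ι ι ℂ} {C : Matrix κ κ ℂ} {A' : Matrix ι' ι' ℂ} {C' : Matrix κ' κ' ℂ}
    (hA : A.PosDef) (hC : C.PosDef) (hA' : A'.PosDef) (hC' : C'.PosDef)
    {a₀ b₀ k₀ a₁ b₁ k₁ θ : ℝ} (hk₀ : 0 < k₀) (hk₁ : 0 < k₁) (hθ : θ ∈ Set.Icc (0 : ℝ) 1)
    (h₀ : ∀ K, weightedHSNormSq (A' ^ a₀) (C' ^ b₀) (T K) ≤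
      k₀ * weightedHSNormSq (A ^ a₀) (C ^ b₀) K)
    (h₁ : ∀ K, weightedHSNormSq (A' ^ a₁) (C' ^ b₁) (T K) ≤
      k₁ * weightedHSNormSq (A ^ a₁) (C ^ b₁) K) (K : Matrix ι κ ℂ) :
    weightedHSNormSq (A' ^ ((1 - θ) * a₀ + θ * a₁)) (C' ^ ((1 - θ) * b₀ + θ * b₁)) (T K) ≤
      k₀ ^ (1 - θ) * k₁ ^ θ *
        weightedHSNormSq (A ^ ((1 - θ) * a₀ + θ * a₁)) (C ^ ((1 - θ) * b₀ + θ * b₁)) K := by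
  simp only [weightedHSNormSq_rpow hA.posSemidef hC.posSemidef,
    weightedHSNormSq_rpow hA'.posSemidef hC'.posSemidef] at h₀ h₁ ⊢
  let coords := eigenCoords hA.1 hC.1
  have h := weightedNormSq_interpolate_of_le_const_mul
    ((eigenCoords hA'.1 hC'.1).toAddMonoidHom.comp (T.comp coords.symm.toAddMonoidHom))
    (eigenWeight_pos hA hC a₀ b₀) (eigenWeight_pos hA hC a₁ b₁)
    (eigenWeight_pos hA' hC' a₀ b₀) (eigenWeight_pos hA' hC' a₁ b₁) hk₀ hk₁
    (fun u => by simpa [coords] using h₀ (coords.symm u))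
    (fun u => by simpa [coords] using h₁ (coords.symm u)) hθ (coords K)
  simpa [eigenWeight_rpow_mul_rpow, hA, hC, hA', hC', coords] using h

end HilbertSchmidt

section VariationalFormula

variable {ι : Type*} [Fintype ι] [DecidableEq ι]

theorem rpow_le_mul_rpow_neg_add {z d q : ℝ} (hz : 0 ≤ z) (hd : 0 < d) (hq0 : 0 < q)
    (hq1 : q ≤ 1) : z ^ q ≤ q * (z * d ^ (-(1 / q - 1))) + (1 - q) * d := by
  have h := Real.geom_mean_le_arith_mean2_weighted hq0.le (sub_nonneg.2 hq1)
    (mul_nonneg hz (Real.rpow_nonneg hd.le (-(1 / q - 1)))) hd.le (by ring)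
  rwa [Real.mul_rpow hz (by positivity), ← Real.rpow_mul hd.le, mul_assoc, ← Real.rpow_add hd,
    show -(1 / q - 1) * q + (1 - q) = 0 by field_simp; ring, Real.rpow_zero, mul_one] at h

theorem re_trace_rpow_le {Z D : Matrix ι ι ℂ} (hZ : Z.PosSemidef) (hD : D.PosDef) {q : ℝ}
    (hq0 : 0 < q) (hq1 : q ≤ 1) :
    (Z ^ q).trace.re ≤ q * (Z * D ^ (-(1 / q - 1))).trace.re + (1 - q) * D.trace.re := by
  have htrace (a b : ℝ) : (Z ^ a * D ^ b).trace.re =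
      weightedNormSq (eigenWeight hZ.1 hD.1 a b) (eigenCoords hZ.1 hD.1 1) := by
    rw [← weightedHSNormSq_rpow hZ hD.posSemidef, weightedHSNormSq, Matrix.conjTranspose_one,
      Matrix.one_mul, Matrix.mul_one]
  have h₁ := htrace q 0
  have h₂ := htrace 1 (-(1 / q - 1))
  have h₃ := htrace 0 1
  rw [CFC.rpow_zero D hD.posSemidef.nonneg, mul_one] at h₁
  rw [CFC.rpow_one Z hZ.nonneg] at h₂
  rw [CFC.rpow_zero Z hZ.nonneg, CFC.rpow_one D hD.posSemidef.nonneg, one_mul] at h₃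
  rw [h₁, h₂, h₃, ← weightedNormSq_const_mul, ← weightedNormSq_const_mul, weightedNormSq,
    weightedNormSq, weightedNormSq, ← Finset.sum_add_distrib]
  refine Finset.sum_le_sum fun p _ => ?_
  rw [← add_mul]
  gcongr
  simpa [eigenWeight] using rpow_le_mul_rpow_neg_add (hZ.eigenvalues_nonneg p.1)
    (hD.eigenvalues_pos p.2) hq0 hq1

theorem mul_mul_rpow_add_rpow_neg_le {z q t ε : ℝ} (hz : 0 ≤ z) (hq0 : 0 < q) (hq1 : q ≤ 1)
    (ht : 0 < t) (hε : 0 ≤ ε) :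
    z * (t * z ^ q + ε) ^ (-(1 / q - 1)) ≤ t ^ (-(1 / q - 1)) * z ^ q := by
  rcases hz.eq_or_lt with rfl | hz
  · simp [hq0.ne']
  have hr : 0 ≤ 1 / q - 1 := sub_nonneg.2 (one_le_one_div hq0 hq1)
  calc z * (t * z ^ q + ε) ^ (-(1 / q - 1)) ≤ z * (t * z ^ q) ^ (-(1 / q - 1)) := by
        gcongr ?_ * ?_
        exact Real.rpow_le_rpow_of_nonpos (by positivity) (by linarith) (by linarith)
    _ = t ^ (-(1 / q - 1)) * z ^ (1 + q * -(1 / q - 1)) := by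
        rw [Real.mul_rpow ht.le (by positivity), ← Real.rpow_mul hz.le, Real.rpow_add hz,
          Real.rpow_one]
        ring
    _ = t ^ (-(1 / q - 1)) * z ^ q := by
        congr 2
        field_simp
        ring

theorem mul_smul_rpow_add_rpow_neg_le {Z : Matrix ι ι ℂ} (hZ : 0 ≤ Z) {q t ε : ℝ}
    (hq0 : 0 < q) (hq1 : q ≤ 1) (ht : 0 < t) (hε : 0 ≤ ε) :
    Z * (t • Z ^ q + ε • (1 : Matrix ι ι ℂ)) ^ (-(1 / q - 1)) ≤ t ^ (-(1 / q - 1)) • Z ^ q := by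
  have hcont (f : ℝ → ℝ) : ContinuousOn f (spectrum ℝ Z) :=
    Matrix.finite_real_spectrum.continuousOn f
  have hspec : ∀ z ∈ spectrum ℝ Z, 0 ≤ z := fun z hz => spectrum_nonneg_of_nonneg hZ hz
  have hC : t • Z ^ q + ε • (1 : Matrix ι ι ℂ) = cfc (fun z => t * z ^ q + ε) Z := by
    rw [cfc_add_const ε (fun z => t * z ^ q) Z (hcont _), cfc_const_mul _ _ _ (hcont _),
      CFC.rpow_eq_cfc_real hZ, Algebra.algebraMap_eq_smul_one]
  have hC0 : 0 ≤ cfc (fun z => t * z ^ q + ε) Z :=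
    cfc_nonneg fun z hz => by have := hspec z hz; positivity
  calc Z * (t • Z ^ q + ε • (1 : Matrix ι ι ℂ)) ^ (-(1 / q - 1))
      = cfc (fun z => z * (t * z ^ q + ε) ^ (-(1 / q - 1))) Z := by
        rw [cfc_mul _ _ _ (hcont _) (hcont _), cfc_id' ℝ Z, hC, CFC.rpow_eq_cfc_real hC0,
          ← cfc_comp' _ _ Z ((Matrix.finite_real_spectrum.image _).continuousOn _) (hcont _)]
    _ ≤ cfc (fun z => t ^ (-(1 / q - 1)) * z ^ q) Z :=
        cfc_mono (fun z hz => mul_mul_rpow_add_rpow_neg_le (hspec z hz) hq0 hq1 ht hε)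
          (hcont _) (hcont _)
    _ = t ^ (-(1 / q - 1)) • Z ^ q := by
        rw [cfc_const_mul _ _ _ (hcont _), CFC.rpow_eq_cfc_real hZ]

theorem exists_posDef_re_trace_mul_rpow_neg_le {Z : Matrix ι ι ℂ} (hZ : Z.PosSemidef)
    {q t ε : ℝ} (hq0 : 0 < q) (hq1 : q ≤ 1) (ht : 0 < t) (hε : 0 < ε) :
    ∃ C : Matrix ι ι ℂ, C.PosDef ∧
      (Z * C ^ (-(1 / q - 1))).trace.re ≤ t ^ (-(1 / q - 1)) * (Z ^ q).trace.re ∧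
      C.trace.re ≤ t * (Z ^ q).trace.re + ε := by
  let δ := ε / (Fintype.card ι + 1)
  have hδ : 0 < δ := by positivity
  refine ⟨t • Z ^ q + δ • (1 : Matrix ι ι ℂ), Matrix.PosDef.posSemidef_add
    ((Matrix.nonneg_iff_posSemidef.1 CFC.rpow_nonneg).smul ht.le) (Matrix.PosDef.one.smul hδ),
    ?_, ?_⟩
  · have h := (Complex.le_def.1 (Matrix.le_iff.1
      (mul_smul_rpow_add_rpow_neg_le hZ.nonneg hq0 hq1 ht hδ.le)).trace_nonneg).1
    rw [Matrix.trace_sub, Matrix.trace_smul, Complex.sub_re, Complex.smul_re] at h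
    exact sub_nonneg.1 h
  · have hcard : δ * Fintype.card ι ≤ ε := by
      rw [div_mul_eq_mul_div, div_le_iff₀ (by positivity)]
      linarith
    simpa [Matrix.trace_smul] using hcard

end VariationalFormula

section Duality

variable {ι κ : Type*} [Fintype ι] [DecidableEq ι] [Fintype κ] [DecidableEq κ]

theorem weightedHSNormSq_inv_mul_mul_inv {P : Matrix ι ι ℂ} {Q : Matrix κ κ ℂ} (hP : P.PosDef)
    (hQ : Q.PosDef) (B : Matrix ι κ ℂ) :
    weightedHSNormSq P Q (P⁻¹ * B * Q⁻¹) = weightedHSNormSq P⁻¹ Q⁻¹ B := by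
  have hPdet := (Matrix.isUnit_iff_isUnit_det P).1 hP.isUnit
  have hQdet := (Matrix.isUnit_iff_isUnit_det Q).1 hQ.isUnit
  rw [weightedHSNormSq, weightedHSNormSq, Matrix.conjTranspose_mul, Matrix.conjTranspose_mul,
    hP.inv.1.eq, hQ.inv.1.eq, Matrix.trace_mul_comm (Bᴴ * P⁻¹ * B)]
  simp only [Matrix.mul_assoc, Matrix.nonsing_inv_mul _ hQdet, Matrix.mul_one,
    Matrix.mul_nonsing_inv_cancel_left _ _ hPdet]

theorem two_mul_re_trace_conjTranspose_mul_le {P : Matrix ι ι ℂ} {Q : Matrix κ κ ℂ}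
    (hP : P.PosDef) (hQ : Q.PosDef) (X B : Matrix ι κ ℂ) :
    2 * (Xᴴ * B).trace.re ≤ weightedHSNormSq P Q X + weightedHSNormSq P⁻¹ Q⁻¹ B := by
  have hPdet := (Matrix.isUnit_iff_isUnit_det P).1 hP.isUnit
  have hQdet := (Matrix.isUnit_iff_isUnit_det Q).1 hQ.isUnit
  have hcross : (Xᴴ * P * (P⁻¹ * B * Q⁻¹) * Q).trace = (Xᴴ * B).trace := by
    simp only [Matrix.mul_assoc, Matrix.nonsing_inv_mul _ hQdet, Matrix.mul_one,
      Matrix.mul_nonsing_inv_cancel_left _ _ hPdet]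
  have hcross' : ((P⁻¹ * B * Q⁻¹)ᴴ * P * X * Q).trace.re = (Xᴴ * B).trace.re := by
    rw [← hcross, ← Complex.conj_re, ← Complex.star_def, ← Matrix.trace_conjTranspose,
      Matrix.trace_mul_comm (Xᴴ * P * _)]
    simp only [Matrix.conjTranspose_mul, Matrix.conjTranspose_conjTranspose, hP.1.eq, hQ.1.eq,
      Matrix.mul_assoc]
  have h := weightedHSNormSq_nonneg hP.posSemidef hQ.posSemidef (X - P⁻¹ * B * Q⁻¹)
  rw [weightedHSNormSq, Matrix.conjTranspose_sub] at h
  simp only [Matrix.sub_mul, Matrix.mul_sub, Matrix.trace_sub, Complex.sub_re, hcross,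
    hcross'] at h
  rw [← weightedHSNormSq_inv_mul_mul_inv hP hQ, weightedHSNormSq, weightedHSNormSq]
  linarith

theorem inv_rpow_eq_rpow_neg {A : Matrix ι ι ℂ} (hA : A.PosDef) (x : ℝ) : (A ^ x)⁻¹ = A ^ (-x) :=
  Matrix.inv_eq_left_inv (CFC.rpow_neg_mul_rpow x hA.isStrictlyPositive)

theorem posDef_rpow {A : Matrix ι ι ℂ} (hA : A.PosDef) (x : ℝ) : (A ^ x).PosDef :=
  Matrix.isStrictlyPositive_iff_posDef.1 (IsStrictlyPositive.rpow A x hA.isStrictlyPositive)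

theorem weightedHSNormSq_hsAdjoint_le {m n : ℕ}
    {Φ : Matrix (Fin m) (Fin m) ℂ →ₗ[ℂ] Matrix (Fin n) (Fin n) ℂ}
    {P Q : Matrix (Fin n) (Fin n) ℂ} {P' Q' : Matrix (Fin m) (Fin m) ℂ} {k : ℝ}
    (hP : P.PosDef) (hQ : Q.PosDef) (hP' : P'.PosDef) (hQ' : Q'.PosDef) (hk : 0 < k)
    (h : ∀ K, weightedHSNormSq P Q (Φ K) ≤ k * weightedHSNormSq P' Q' K)
    (B : Matrix (Fin n) (Fin n) ℂ) :
    weightedHSNormSq P'⁻¹ Q'⁻¹ (hsAdjoint Φ B) ≤ k * weightedHSNormSq P⁻¹ Q⁻¹ B := by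
  set N := weightedHSNormSq P'⁻¹ Q'⁻¹ (hsAdjoint Φ B) with hN
  set M := weightedHSNormSq P⁻¹ Q⁻¹ B with hM
  let K := P'⁻¹ * hsAdjoint Φ B * Q'⁻¹
  have hK : weightedHSNormSq P' Q' K = N := weightedHSNormSq_inv_mul_mul_inv hP' hQ' _
  have hpair : ((Φ K)ᴴ * B).trace.re = N := by
    change (hsInner (Φ K) B).re = N
    rw [← hsInner_hsAdjoint, hsInner, ← Complex.conj_re, ← Complex.star_def,
      ← Matrix.trace_conjTranspose, hN, weightedHSNormSq]
    simp only [K, Matrix.conjTranspose_mul, Matrix.conjTranspose_conjTranspose, Matrix.mul_assoc]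
  have hscale : weightedHSNormSq P⁻¹ Q⁻¹ ((k : ℂ) • B) = k ^ 2 * M := by
    simp only [hM, weightedHSNormSq, Matrix.conjTranspose_smul, Matrix.smul_mul, Matrix.mul_smul,
      Matrix.trace_smul, smul_eq_mul, Complex.star_def, Complex.conj_ofReal, Complex.re_ofReal_mul]
    ring
  have hfenchel := two_mul_re_trace_conjTranspose_mul_le hP hQ (Φ K) ((k : ℂ) • B)
  rw [hscale, Matrix.mul_smul, Matrix.trace_smul, smul_eq_mul, Complex.re_ofReal_mul,
    hpair] at hfenchel
  have hΦK := h K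
  rw [hK] at hΦK
  exact le_of_mul_le_mul_left (by linarith : k * N ≤ k * (k * M)) hk

end Duality

section Schwarz

variable {m n : ℕ} {Φ : Matrix (Fin m) (Fin m) ℂ →ₗ[ℂ] Matrix (Fin n) (Fin n) ℂ}

theorem IsSchwarzMap.map_nonneg (hΦ : IsSchwarzMap Φ) {P : Matrix (Fin m) (Fin m) ℂ}
    (hP : 0 ≤ P) : 0 ≤ Φ P := by
  obtain ⟨L, rfl⟩ := CStarAlgebra.nonneg_iff_eq_star_mul_self.1 hP
  exact (Matrix.posSemidef_conjTranspose_mul_self (Φ L)).nonneg.trans (Matrix.le_iff.2 (hΦ L))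

theorem IsSchwarzMap.map_conjTranspose (hΦ : IsSchwarzMap Φ) (K : Matrix (Fin m) (Fin m) ℂ) :
    Φ Kᴴ = (Φ K)ᴴ :=
  map_star (PositiveLinearMap.mk₀ Φ fun _ => hΦ.map_nonneg) K

theorem IsSchwarzMap.trace_map_mul (hΦ : IsSchwarzMap Φ) (X : Matrix (Fin m) (Fin m) ℂ)
    (Y : Matrix (Fin n) (Fin n) ℂ) : (Φ X * Y).trace = (X * hsAdjoint Φ Y).trace := by
  simpa only [hsInner, hΦ.map_conjTranspose, Matrix.conjTranspose_conjTranspose] using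
    (hsInner_hsAdjoint Φ Xᴴ Y).symm

theorem IsSchwarzMap.posSemidef_hsAdjoint (hΦ : IsSchwarzMap Φ) {P : Matrix (Fin n) (Fin n) ℂ}
    (hP : P.PosSemidef) : (hsAdjoint Φ P).PosSemidef := by
  refine Matrix.PosSemidef.of_dotProduct_mulVec_nonneg ?_ fun x => ?_
  · ext i j
    rw [Matrix.conjTranspose_apply]
    change star (hsInner (Φ (Matrix.single j i 1)) P) = hsInner (Φ (Matrix.single i j 1)) P
    rw [hsInner, hsInner, ← Matrix.trace_conjTranspose, Matrix.conjTranspose_mul,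
      Matrix.conjTranspose_conjTranspose, hP.1.eq, Matrix.trace_mul_comm,
      ← hΦ.map_conjTranspose, Matrix.conjTranspose_single, star_one]
  · have htest : star x ⬝ᵥ hsAdjoint Φ P *ᵥ x =
        (Φ (Matrix.vecMulVec x (star x)) * P).trace := by
      rw [hΦ.trace_map_mul, Matrix.trace_mul_comm, Matrix.mul_vecMulVec, Matrix.trace_vecMulVec,
        dotProduct_comm]
    rw [htest]
    exact trace_mul_nonneg (Matrix.nonneg_iff_posSemidef.1
      (hΦ.map_nonneg (Matrix.posSemidef_vecMulVec_self_star x).nonneg)) hP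

theorem exists_pos_smul_one_le {ι : Type*} [Finite ι] [DecidableEq ι] {A : Matrix ι ι ℂ}
    (hA : A.PosDef) : ∃ c : ℝ, 0 < c ∧ (c : ℂ) • (1 : Matrix ι ι ℂ) ≤ A := by
  cases nonempty_fintype ι
  rcases isEmpty_or_nonempty ι with hι | hι
  · exact ⟨1, one_pos, (Subsingleton.elim _ _).le⟩
  obtain ⟨c, hc, hle⟩ := (CFC.exists_pos_algebraMap_le_iff hA.1).2
    fun _ hx => hA.isStrictlyPositive.spectrum_pos hx
  exact ⟨c, hc, by rwa [Algebra.algebraMap_eq_smul_one] at hle⟩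

theorem IsSchwarzMap.posDef_hsAdjoint (hΦ : IsSchwarzMap Φ) (h1 : (hsAdjoint Φ 1).PosDef)
    {A : Matrix (Fin n) (Fin n) ℂ} (hA : A.PosDef) : (hsAdjoint Φ A).PosDef := by
  obtain ⟨c, hc, hle⟩ := exists_pos_smul_one_le hA
  rw [← sub_add_cancel A ((c : ℂ) • 1), map_add, map_smul]
  exact Matrix.PosDef.posSemidef_add (hΦ.posSemidef_hsAdjoint (Matrix.le_iff.1 hle))
    (h1.smul (by exact_mod_cast hc))

theorem IsSchwarzMap.map_one_le (hΦ : IsSchwarzMap Φ) : Φ 1 ≤ 1 := by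
  have hstar : (Φ 1)ᴴ = Φ 1 := by rw [← hΦ.map_conjTranspose, Matrix.conjTranspose_one]
  have hsum := (hΦ 1).add (Matrix.posSemidef_conjTranspose_mul_self (1 - Φ 1))
  simp only [Matrix.conjTranspose_sub, Matrix.conjTranspose_one, hstar, one_mul] at hsum
  have hsplit : 1 - Φ 1 = Φ 1 - Φ 1 * Φ 1 + (1 - Φ 1) * (1 - Φ 1) := by noncomm_ring
  rwa [Matrix.le_iff, hsplit]

theorem IsSchwarzMap.re_trace_hsAdjoint_le (hΦ : IsSchwarzMap Φ) {P : Matrix (Fin n) (Fin n) ℂ}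
    (hP : P.PosSemidef) : (hsAdjoint Φ P).trace.re ≤ P.trace.re := by
  have h := re_trace_mul_le_re_trace_mul hΦ.map_one_le hP
  rwa [hΦ.trace_map_mul, one_mul, one_mul] at h

theorem IsSchwarzMap.weightedHSNormSq_left_le (hΦ : IsSchwarzMap Φ)
    {P : Matrix (Fin n) (Fin n) ℂ} (hP : P.PosSemidef) (K : Matrix (Fin m) (Fin m) ℂ) :
    weightedHSNormSq P (1 : Matrix (Fin n) (Fin n) ℂ) (Φ K) ≤
      weightedHSNormSq (hsAdjoint Φ P) (1 : Matrix (Fin m) (Fin m) ℂ) K := by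
  have hK := hΦ Kᴴ
  rw [Matrix.conjTranspose_conjTranspose, hΦ.map_conjTranspose,
    Matrix.conjTranspose_conjTranspose] at hK
  rw [weightedHSNormSq, weightedHSNormSq, mul_one, mul_one, Matrix.trace_mul_cycle (Φ K)ᴴ,
    Matrix.trace_mul_cycle Kᴴ, ← hΦ.trace_map_mul]
  exact re_trace_mul_le_re_trace_mul (Matrix.le_iff.2 hK) hP

theorem IsSchwarzMap.weightedHSNormSq_right_le (hΦ : IsSchwarzMap Φ)
    {P : Matrix (Fin n) (Fin n) ℂ} (hP : P.PosSemidef) (K : Matrix (Fin m) (Fin m) ℂ) :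
    weightedHSNormSq (1 : Matrix (Fin n) (Fin n) ℂ) P (Φ K) ≤
      weightedHSNormSq (1 : Matrix (Fin m) (Fin m) ℂ) (hsAdjoint Φ P) K := by
  rw [weightedHSNormSq, weightedHSNormSq, mul_one, mul_one, ← hΦ.trace_map_mul]
  exact re_trace_mul_le_re_trace_mul (Matrix.le_iff.2 (hΦ K)) hP

theorem IsSchwarzMap.weightedHSNormSq_one_le (hΦ : IsSchwarzMap Φ) {c : ℝ}
    (hc : hsAdjoint Φ 1 ≤ (c : ℂ) • 1) (K : Matrix (Fin m) (Fin m) ℂ) :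
    weightedHSNormSq (1 : Matrix (Fin n) (Fin n) ℂ) (1 : Matrix (Fin n) (Fin n) ℂ) (Φ K) ≤
      c * weightedHSNormSq (1 : Matrix (Fin m) (Fin m) ℂ) (1 : Matrix (Fin m) (Fin m) ℂ) K := by
  refine (hΦ.weightedHSNormSq_right_le Matrix.PosSemidef.one K).trans ?_
  have h := re_trace_mul_le_re_trace_mul hc (Matrix.posSemidef_conjTranspose_mul_self K)
  rw [Matrix.smul_mul, Matrix.one_mul, Matrix.trace_smul, smul_eq_mul,
    Complex.re_ofReal_mul] at h
  rwa [weightedHSNormSq, weightedHSNormSq, Matrix.mul_one, Matrix.mul_one,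
    Matrix.trace_mul_comm]

theorem IsSchwarzMap.weightedHSNormSq_rpow_le (hΦ : IsSchwarzMap Φ) {c : ℝ} (hc0 : 0 < c)
    (h1 : (hsAdjoint Φ 1).PosDef) (hc : hsAdjoint Φ 1 ≤ (c : ℂ) • 1)
    {A C : Matrix (Fin n) (Fin n) ℂ} (hA : A.PosDef) (hC : C.PosDef) {s r : ℝ}
    (hs : 0 ≤ s) (hr : 0 ≤ r) (hsr : s + r ≤ 1) (K : Matrix (Fin m) (Fin m) ℂ) :
    weightedHSNormSq (A ^ s) (C ^ r) (Φ K) ≤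
      c ^ (1 - s - r) * weightedHSNormSq (hsAdjoint Φ A ^ s) (hsAdjoint Φ C ^ r) K := by
  have hA' := hΦ.posDef_hsAdjoint h1 hA
  have hC' := hΦ.posDef_hsAdjoint h1 hC
  have hzero {k : ℕ} {P : Matrix (Fin k) (Fin k) ℂ} (hP : P.PosDef) : P ^ (0 : ℝ) = 1 :=
    CFC.rpow_zero P hP.posSemidef.nonneg
  have hone {k : ℕ} {P : Matrix (Fin k) (Fin k) ℂ} (hP : P.PosDef) : P ^ (1 : ℝ) = P :=
    CFC.rpow_one P hP.posSemidef.nonneg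
  have h₀₀ := hΦ.weightedHSNormSq_one_le hc
  have h₀₁ := hΦ.weightedHSNormSq_right_le hC.posSemidef
  have h₁₀ := hΦ.weightedHSNormSq_left_le hA.posSemidef
  let θ := r / (1 - s)
  have hθ : θ ∈ Set.Icc (0 : ℝ) 1 :=
    ⟨div_nonneg hr (by linarith), div_le_one_of_le₀ (by linarith) (by linarith)⟩
  have hθr : (1 - s) * θ = r := mul_div_cancel_of_imp' fun h => by linarith
  have hedge := weightedHSNormSq_interpolate Φ.toAddMonoidHom hA' hC' hA hC
    (a₀ := 0) (b₀ := 0) (a₁ := 0) (b₁ := 1) hc0 one_pos hθ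
    (by simpa [hzero, hA, hC, hA', hC'] using h₀₀)
    (by simpa [hzero, hone, hA, hC, hA', hC'] using h₀₁)
  have h := weightedHSNormSq_interpolate Φ.toAddMonoidHom hA' hC' hA hC (a₁ := 1) (b₁ := 0)
    (k₁ := 1) (by positivity) one_pos ⟨hs, by linarith⟩ hedge
    (by simpa [hzero, hone, hA, hC, hA', hC'] using h₁₀) K
  have hexp : (1 - θ) * (1 - s) = 1 - s - r := by linear_combination -hθr
  simpa [← Real.rpow_mul hc0.le, hexp, hθr] using h

theorem IsSchwarzMap.weightedHSNormSq_hsAdjoint_rpow_neg_le (hΦ : IsSchwarzMap Φ) {c : ℝ}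
    (hc0 : 0 < c) (h1 : (hsAdjoint Φ 1).PosDef) (hc : hsAdjoint Φ 1 ≤ (c : ℂ) • 1)
    {A C : Matrix (Fin n) (Fin n) ℂ} (hA : A.PosDef) (hC : C.PosDef) {s r : ℝ}
    (hs : 0 ≤ s) (hr : 0 ≤ r) (hsr : s + r ≤ 1) (B : Matrix (Fin n) (Fin n) ℂ) :
    weightedHSNormSq (hsAdjoint Φ A ^ (-s)) (hsAdjoint Φ C ^ (-r)) (hsAdjoint Φ B) ≤
      c ^ (1 - s - r) * weightedHSNormSq (A ^ (-s)) (C ^ (-r)) B := by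
  have hA' := hΦ.posDef_hsAdjoint h1 hA
  have hC' := hΦ.posDef_hsAdjoint h1 hC
  simpa only [inv_rpow_eq_rpow_neg, hA, hC, hA', hC'] using
    weightedHSNormSq_hsAdjoint_le (posDef_rpow hA s) (posDef_rpow hC r) (posDef_rpow hA' s)
      (posDef_rpow hC' r) (Real.rpow_pos_of_pos hc0 _)
      (hΦ.weightedHSNormSq_rpow_le hc0 h1 hc hA hC hs hr hsr) B

end Schwarz

section TraceInequality

variable {m n : ℕ} {Φ : Matrix (Fin m) (Fin m) ℂ →ₗ[ℂ] Matrix (Fin n) (Fin n) ℂ}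

theorem IsSchwarzMap.re_trace_rpow_hsAdjoint_le (hΦ : IsSchwarzMap Φ) {c : ℝ} (hc0 : 0 < c)
    (h1 : (hsAdjoint Φ 1).PosDef) (hc : hsAdjoint Φ 1 ≤ (c : ℂ) • 1)
    {A : Matrix (Fin n) (Fin n) ℂ} (hA : A.PosDef) (B : Matrix (Fin n) (Fin n) ℂ) {s q : ℝ}
    (hs : 0 ≤ s) (hq0 : 0 < q) (hq1 : q ≤ 1) (hsq : s + (1 / q - 1) ≤ 1) :
    (((hsAdjoint Φ B)ᴴ * hsAdjoint Φ A ^ (-s) * hsAdjoint Φ B) ^ q).trace.re ≤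
      c ^ ((2 - s) * q - 1) * ((Bᴴ * A ^ (-s) * B) ^ q).trace.re := by
  set Z := Bᴴ * A ^ (-s) * B
  set W := (hsAdjoint Φ B)ᴴ * hsAdjoint Φ A ^ (-s) * hsAdjoint Φ B
  set t := c ^ ((2 - s) * q - 1) with ht
  have hZ : Z.PosSemidef := (posDef_rpow hA (-s)).posSemidef.conjTranspose_mul_mul_same B
  have hW : W.PosSemidef :=
    (posDef_rpow (hΦ.posDef_hsAdjoint h1 hA) (-s)).posSemidef.conjTranspose_mul_mul_same _
  have hr : 0 ≤ 1 / q - 1 := sub_nonneg.2 (one_le_one_div hq0 hq1)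
  have hexp : c ^ (1 - s - (1 / q - 1)) * t ^ (-(1 / q - 1)) = t := by
    rw [ht, ← Real.rpow_mul hc0.le, ← Real.rpow_add hc0]
    congr 1
    field_simp
    ring
  refine le_of_forall_pos_le_add fun ε hε => ?_
  obtain ⟨C, hC, hZC, htrC⟩ := exists_posDef_re_trace_mul_rpow_neg_le hZ hq0 hq1
    (Real.rpow_pos_of_pos hc0 _ : 0 < t) hε
  have hWC : (W * hsAdjoint Φ C ^ (-(1 / q - 1))).trace.re ≤ t * (Z ^ q).trace.re :=
    calc (W * hsAdjoint Φ C ^ (-(1 / q - 1))).trace.re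
        ≤ c ^ (1 - s - (1 / q - 1)) * (Z * C ^ (-(1 / q - 1))).trace.re :=
          hΦ.weightedHSNormSq_hsAdjoint_rpow_neg_le hc0 h1 hc hA hC hs hr hsq B
      _ ≤ c ^ (1 - s - (1 / q - 1)) * (t ^ (-(1 / q - 1)) * (Z ^ q).trace.re) := by gcongr
      _ = t * (Z ^ q).trace.re := by rw [← mul_assoc, hexp]
  have htrΦC := (hΦ.re_trace_hsAdjoint_le hC.posSemidef).trans htrC
  calc (W ^ q).trace.re
      ≤ q * (W * hsAdjoint Φ C ^ (-(1 / q - 1))).trace.re +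
          (1 - q) * (hsAdjoint Φ C).trace.re :=
        re_trace_rpow_le hW (hΦ.posDef_hsAdjoint h1 hC) hq0 hq1
    _ ≤ q * (t * (Z ^ q).trace.re) + (1 - q) * (t * (Z ^ q).trace.re + ε) :=
        add_le_add (mul_le_mul_of_nonneg_left hWC hq0.le)
          (mul_le_mul_of_nonneg_left htrΦC (sub_nonneg.2 hq1))
    _ ≤ t * (Z ^ q).trace.re + ε := by linarith [mul_pos hq0 hε]

end TraceInequality

end SesquiunitalSchwarz

open SesquiunitalSchwarz

theorem theorem4p4_general (m n : ℕ) (s q : ℝ) (hs0 : 0 ≤ s) (hs1 : s ≤ 1)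
    (hq : 1 / (2 - s) ≤ q) (hq1 : q ≤ 1)
    (Φ : Matrix (Fin m) (Fin m) ℂ →ₗ[ℂ] Matrix (Fin n) (Fin n) ℂ) (hΦ : IsSchwarzMap Φ)
    (c : ℝ) (hc0 : 0 < c) (h1 : (hsAdjoint Φ 1).PosDef) (hc : hsAdjoint Φ 1 ≤ (c : ℂ) • 1)
    (A : Matrix (Fin n) (Fin n) ℂ) (hA : A.PosDef) (B : Matrix (Fin n) (Fin n) ℂ) :
    ((c ^ ((2 - s) * q - 1) : ℝ) : ℂ) * ((Bᴴ * A ^ (-s) * B) ^ q).trace ≥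
      (((hsAdjoint Φ B)ᴴ * (hsAdjoint Φ A) ^ (-s) * hsAdjoint Φ B) ^ q).trace := by
  have hq0 : 0 < q := (one_div_pos.2 (by linarith)).trans_le hq
  have hsq : s + (1 / q - 1) ≤ 1 := by
    linarith [(one_div_le (by linarith) hq0).1 hq]
  rw [trace_rpow_eq_ofReal_re (Bᴴ * _ * B), trace_rpow_eq_ofReal_re ((hsAdjoint Φ B)ᴴ * _ * _)]
  exact_mod_cast hΦ.re_trace_rpow_hsAdjoint_le hc0 h1 hc hA B hs0 hq0 hq1 hsq

/-- Real powers of matrices are taken in the continuous functional calculus (`CFC.rpow`), and the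
inequality between traces is that of `ℂ`, so that it includes that both sides are real. -/
theorem theorem4p4 (m n : ℕ) (hm : 0 < m) (hn : 0 < n) (s q : ℝ)
    (hs0 : 0 ≤ s) (hs1 : s < 1) (hq : 1 / (2 - s) ≤ q) (hq1 : q < 1)
    (Φ : Matrix (Fin m) (Fin m) ℂ →ₗ[ℂ] Matrix (Fin n) (Fin n) ℂ)
    (hΦ : SesquiunitalSchwarz.IsSchwarzMap Φ)
    (hΦ1 : SesquiunitalSchwarz.IsSesquiunital Φ)
    (A : Matrix (Fin n) (Fin n) ℂ) (hA : A.PosDef)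
    (B : Matrix (Fin n) (Fin n) ℂ) (hB : IsUnit B) :
    ((((n : ℝ) / (m : ℝ)) ^ ((2 - s) * q - 1) : ℝ) : ℂ) *
        ((Bᴴ * A ^ (-s) * B) ^ q).trace ≥
      (((SesquiunitalSchwarz.hsAdjoint Φ B)ᴴ * (SesquiunitalSchwarz.hsAdjoint Φ A) ^ (-s) *
        SesquiunitalSchwarz.hsAdjoint Φ B) ^ q).trace := by
  have hc : (0 : ℝ) < n / m := by positivity
  have hc' : (0 : ℂ) < n / m := div_pos (Nat.cast_pos.2 hn) (Nat.cast_pos.2 hm)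
  exact theorem4p4_general m n s q hs0 hs1.le hq hq1.le Φ hΦ (n / m) hc
    (hΦ1.2 ▸ Matrix.PosDef.one.smul hc') (by rw [hΦ1.2]; push_cast; rfl) A hA B
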